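/- Let $\mathcal H,\mathcal K$ be separable complex Hilbert spaces, $U$ unitary on $\mathcal H$, $A:\mathcal H\to\mathcal K$ bounded, $W$ bounded and self-adjoint on $\mathcal K$, $\hbar>0$, and $J\subseteq[0,2\pi)$. For $\epsilon>0$ and $|z|\ne1$ put $$G_\epsilon(\theta)=A\,F_\epsilon(\theta)^*F_\epsilon(\theta)A^*,\quad F_\epsilon(\theta)=\bigl(1-Ue^{i(\theta+i\epsilon)}\bigr)^{-1},\qquad Q(z)=A(1-Uz)^{-1}A^*,$$ and let $$N(U,A,J)=\{\theta\in J:\ \text{the strong limit of } G_\epsilon(\theta) \text{ as } \epsilon\downarrow0 \text{ does not exist}\},$$ $$M(U,A,J)=\{\theta\in J:\ \text{the operator-norm limits of } Q(e^{i(\theta\pm i\epsilon)}) \text{ as } \epsilon\downarrow0 \text{ do not both exist}\}.$$ Assume: (i) $A$ is $U$-finite on $J$, i.e. the strong limit of $G_\epsilon(\theta)$ as $\epsilon\downarrow0$ exists as a bounded operator for a.e. $\theta\in J$; (ii) the range $R(A^*)$ is cyclic for $U$, i.e. the smallest closed subspace of $\mathcal H$ that contains $R(A^*)$ and reduces $U$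 is $\mathcal H$; (iii) $Q(z)$ is compact for all $|z|\neq1$; (iv) for a.e. $\theta\in J$ the limits of $Q(e^{i(\theta\pm i\epsilon)})$ as $\epsilon\downarrow0$ exist in operator norm. Let $V=e^{iA^*WA/\hbar}U$, write $V=\int_{[0,2\pi)}e^{-i\theta}E(d\theta)$, and for $x\in\mathcal H$ let $m_x(\cdot)=\langle E(\cdot)x,x\rangle$, with absolutely continuous and singular continuous parts $m_x^{ac}$, $m_x^{sc}$ with respect to Lebesgue measure. Then: (a) $V$ has no absolutely continuous spectrum in $J$: $m_x^{ac}(J)=0$ for every $x\in\mathcal H$; (b) the singular continuous spectrum of $V$ in $J$ is supported by $N(U,A,J)\cup M(U,A,J)$: $m_x^{sc}\bigl(J\setminus(N(U,A,J)\cup M(U,A,J))\bigr)=0$ for every $x\in\mathcal H$. (If a set $B$ here is not measurable, $m(B)=0$ means that $B$ is contained in a Borel set of $m$-measure zero.) -/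

import Mathlib

open MeasureTheory Filter Topology CompactlySupported

noncomputable section

namespace Floquet

variable {H K : Type*}
  [NormedAddCommGroup H] [InnerProductSpace ℂ H] [CompleteSpace H]
  [NormedAddCommGroup K] [InnerProductSpace ℂ K] [CompleteSpace K]

/-! ### Spectral measures of a unitary operator -/

/-- A unitary operator is normal. -/
theorem isStarNormal_of_unitary (V : unitary (H →L[ℂ] H)) : IsStarNormal (V : H →L[ℂ] H) :=
  inferInstance

/-- The real continuous function `f` on the spectrum of `V`, as a complex-valued function. -/
def complexify {V : unitary (H →L[ℂ] H)} (f : C_c(spectrum ℂ (V : H →L[ℂ] H), ℝ)) :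
    C(spectrum ℂ (V : H →L[ℂ] H), ℂ) :=
  ⟨fun w => ((f w : ℝ) : ℂ), Complex.continuous_ofReal.comp f.continuous⟩

/-- The operator `f(V)` for a continuous function `f` on the spectrum of `V`. -/
def funcCalc (V : unitary (H →L[ℂ] H)) (f : C(spectrum ℂ (V : H →L[ℂ] H), ℂ)) : H →L[ℂ] H :=
  cfcHom (R := ℂ) (isStarNormal_of_unitary V) f

/-- `f ↦ ⟨f(V) x, x⟩` as a linear functional on real continuous functions on the spectrum. -/
def spectralFunctionalLin (V : unitary (H →L[ℂ] H)) (x : H) :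
    C_c(spectrum ℂ (V : H →L[ℂ] H), ℝ) →ₗ[ℝ] ℝ where
  toFun f := (inner ℂ x (funcCalc V (complexify f) x)).re
  map_add' f g := by
    have h : complexify (f + g) = complexify f + complexify g := by
      ext w; simp [complexify]
    simp [h, funcCalc]
  map_smul' c f := by
    have h : complexify (c • f) = (c : ℂ) • complexify f := by
      ext w; simp [complexify]
    simp [h, funcCalc]

/-- The functional `f ↦ ⟨f(V) x, x⟩` is positive. -/
theorem spectralFunctionalLin_nonneg (V : unitary (H →L[ℂ] H)) (x : H)
    (f : C_c(spectrum ℂ (V : H →L[ℂ] H), ℝ)) (hf : 0 ≤ f) :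
    0 ≤ spectralFunctionalLin V x f := by
  have hf' : ∀ w, 0 ≤ f w := fun w => hf w
  set g : C(spectrum ℂ (V : H →L[ℂ] H), ℂ) :=
    ⟨fun w => ((Real.sqrt (f w) : ℝ) : ℂ),
      Complex.continuous_ofReal.comp (Real.continuous_sqrt.comp f.continuous)⟩ with hg
  have h : complexify f = star g * g := by
    ext w
    simp only [complexify, hg, ContinuousMap.coe_mk, ContinuousMap.mul_apply,
      ContinuousMap.star_apply, RCLike.star_def, Complex.conj_ofReal]
    rw [← Complex.ofReal_mul, Real.mul_self_sqrt (hf' w)]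
  change 0 ≤ (inner ℂ x (funcCalc V (complexify f) x)).re
  rw [h, funcCalc, map_mul, map_star, ContinuousLinearMap.star_eq_adjoint,
    mul_apply_eq_comp, ContinuousLinearMap.adjoint_inner_right]
  exact inner_self_nonneg (𝕜 := ℂ)

/-- The positive functional `f ↦ ⟨f(V) x, x⟩`. -/
def spectralFunctional (V : unitary (H →L[ℂ] H)) (x : H) :
    C_c(spectrum ℂ (V : H →L[ℂ] H), ℝ) →ₚ[ℝ] ℝ :=
  PositiveLinearMap.mk₀ (spectralFunctionalLin V x) (spectralFunctionalLin_nonneg V x)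

/-- The angle `θ ∈ [0, 2π)` with `w / |w| = e^{-iθ}`. -/
def angle (w : ℂ) : ℝ := toIcoMod Real.two_pi_pos 0 (-Complex.arg w)

/-- The spectral measure `m_x(S) = ⟨E(S) x, x⟩` of the vector `x` for the unitary operator
`V = ∫ e^{-iθ} E(dθ)`, a measure on `ℝ` carried by `[0, 2π)`. It is the measure that the
Riesz–Markov–Kakutani theorem attaches to `f ↦ ⟨f(V) x, x⟩`, written in the coordinate `θ`. -/
def spectralMeasure (V : unitary (H →L[ℂ] H)) (x : H) : Measure ℝ :=
  (RealRMK.rieszMeasure (spectralFunctional V x)).map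
    (fun w : spectrum ℂ (V : H →L[ℂ] H) => angle (w : ℂ))

/-- The absolutely continuous part `μ^{ac}` of a measure on the line. -/
def acPart (μ : Measure ℝ) : Measure ℝ := volume.withDensity (μ.rnDeriv volume)

/-- The singular continuous part `μ^{sc}` of a measure on the line: the Lebesgue-singular part
with the atoms removed. -/
def scPart (μ : Measure ℝ) : Measure ℝ := (μ.singularPart volume).restrict {θ | μ {θ} = 0}

/-- `V` has no absolutely continuous spectrum in `J`: `m_x^{ac}(J) = 0` for all `x`. -/
def NoACSpectrumIn (V : unitary (H →L[ℂ] H)) (J : Set ℝ) : Prop :=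
  ∀ x : H, acPart (spectralMeasure V x) J = 0

/-- The singular continuous spectrum of `V` in `J` is supported by `S`:
`m_x^{sc}(J ∖ S) = 0` for all `x`. -/
def SCSpectrumInSupportedBy (V : unitary (H →L[ℂ] H)) (J S : Set ℝ) : Prop :=
  ∀ x : H, scPart (spectralMeasure V x) (J \ S) = 0

/-! ### Resolvents, `U`-finiteness and exceptional sets -/

/-- The point `e^{i(θ + iε)}`; it lies inside the unit circle for `ε > 0`, outside for `ε < 0`. -/
def radialPoint (θ ε : ℝ) : ℂ := Complex.exp (Complex.I * ((θ : ℂ) + (ε : ℂ) * Complex.I))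

/-- `(1 - U z)⁻¹`; for unitary `U` the inverse exists whenever `|z| ≠ 1`. -/
def resolventAt (U : unitary (H →L[ℂ] H)) (z : ℂ) : H →L[ℂ] H :=
  Ring.inverse (1 - z • (U : H →L[ℂ] H))

/-- `G_ε(θ; U, A) = A F(θ + iε; U)^* F(θ + iε; U) A^*`, with `F(θ; U) = (1 - U e^{iθ})⁻¹`. -/
def G (U : unitary (H →L[ℂ] H)) (A : H →L[ℂ] K) (ε θ : ℝ) : K →L[ℂ] K :=
  A ∘L (resolventAt U (radialPoint θ ε)).adjoint ∘L resolventAt U (radialPoint θ ε) ∘L A.adjoint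

/-- `s-lim_{ε ↓ 0} G_ε(θ; U, A)` exists as a bounded operator. -/
def GStrongLimitExists (U : unitary (H →L[ℂ] H)) (A : H →L[ℂ] K) (θ : ℝ) : Prop :=
  ∃ G₀ : K →L[ℂ] K, ∀ x : K, Tendsto (fun ε : ℝ => G U A ε θ x) (𝓝[>] 0) (𝓝 (G₀ x))

/-- The bounded operator `A` is `U`-finite on `J`. -/
def IsUFinite (U : unitary (H →L[ℂ] H)) (A : H →L[ℂ] K) (J : Set ℝ) : Prop :=
  ∀ᵐ θ : ℝ, θ ∈ J → GStrongLimitExists U A θ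

/-- The exceptional set `N(U, A, J)`. -/
def setN (U : unitary (H →L[ℂ] H)) (A : H →L[ℂ] K) (J : Set ℝ) : Set ℝ :=
  {θ ∈ J | ¬ GStrongLimitExists U A θ}

/-- `Q(z) = A (1 - U z)⁻¹ A^*`. -/
def Q (U : unitary (H →L[ℂ] H)) (A : H →L[ℂ] K) (z : ℂ) : K →L[ℂ] K :=
  A ∘L resolventAt U z ∘L A.adjoint

/-- The boundary values `Q(e^{i(θ ± i0)})`, from inside and from outside the unit circle, exist in
operator norm. -/
def QNormLimitExists (U : unitary (H →L[ℂ] H)) (A : H →L[ℂ] K) (θ : ℝ) : Prop :=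
  (∃ Q₀ : K →L[ℂ] K, Tendsto (fun ε : ℝ => Q U A (radialPoint θ ε)) (𝓝[>] 0) (𝓝 Q₀)) ∧
  (∃ Q₀ : K →L[ℂ] K, Tendsto (fun ε : ℝ => Q U A (radialPoint θ (-ε))) (𝓝[>] 0) (𝓝 Q₀))

/-- The exceptional set `M(U, A, J)`. -/
def setM (U : unitary (H →L[ℂ] H)) (A : H →L[ℂ] K) (J : Set ℝ) : Set ℝ :=
  {θ ∈ J | ¬ QNormLimitExists U A θ}

/-- The subspace `S` reduces `T`: both `S` and its orthogonal complement are invariant. -/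
def Reduces (S : Submodule ℂ H) (T : H →L[ℂ] H) : Prop :=
  (∀ x ∈ S, T x ∈ S) ∧ (∀ x ∈ Sᗮ, T x ∈ Sᗮ)

/-- The set `Y` is cyclic for `T`: the only closed subspace reducing `T` and containing `Y` is the
whole space. -/
def IsCyclicFor (Y : Set H) (T : H →L[ℂ] H) : Prop :=
  ∀ S : Submodule ℂ H, IsClosed (S : Set H) → Reduces S T → Y ⊆ S → S = ⊤

/-! ### The Floquet operator -/

/-- `e^{i A^* W A / ħ}` is unitary when `W` is self-adjoint. -/
theorem exp_kick_mem_unitary (A : H →L[ℂ] K) (W : K →L[ℂ] K) (hW : IsSelfAdjoint W) (hbar : ℝ) :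
    NormedSpace.exp ((Complex.I / (hbar : ℂ)) • (A.adjoint ∘L W ∘L A)) ∈
      unitary (H →L[ℂ] H) := by
  have h1 : IsSelfAdjoint (A.adjoint ∘L W ∘L A) := hW.adjoint_conj A
  have h2 : IsSelfAdjoint (((hbar⁻¹ : ℝ) : ℂ) • (A.adjoint ∘L W ∘L A)) := by
    rw [IsSelfAdjoint, star_smul, h1.star_eq]
    simp
  have h3 := (selfAdjoint.expUnitary (⟨_, h2⟩ : selfAdjoint (H →L[ℂ] H))).2
  rw [selfAdjoint.expUnitary_coe, smul_smul] at h3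
  simpa [div_eq_mul_inv] using h3

/-- The Floquet operator `V = e^{i A^* W A / ħ} U`. -/
def floquetOperator (U : unitary (H →L[ℂ] H)) (A : H →L[ℂ] K) (W : K →L[ℂ] K)
    (hW : IsSelfAdjoint W) (hbar : ℝ) : unitary (H →L[ℂ] H) :=
  ⟨NormedSpace.exp ((Complex.I / (hbar : ℂ)) • (A.adjoint ∘L W ∘L A)),
    exp_kick_mem_unitary A W hW hbar⟩ * U

end Floquet

end

/-! The exponential series gives V = (1 + A*ZA)U with Z bounded on K, hence on R(A*) the resolvent
identity R_V(z)A*(1 + ZAA* - ZQ(z)) = R_U(z)A*. Fix θ in J outside N ∪ M and let z approach e^{iθ}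
radially from inside the circle. Then Q(z) tends in norm to a compact Q₀, while R_U(z)A*y stays
bounded along a sequence, because its squared norm is ⟨G_ε(θ)y, y⟩. As 1 + ZAA* is invertible, the
Fredholm alternative applies to 1 + ZAA* - ZQ₀ (`mem_eigenAngles_or_bounded`). If this operator is
invertible, R_V(z)A*y stays bounded. If it kills some φ ≠ 0, a weak cluster point of R_U(z)A*φ is an
eigenvector of V with eigenvalue e^{-iθ}.

Boundedness of R_V(z)A*y makes the m_{A*y}-mass of a window of radius ε about θ of order ε²
(`spectralMeasure_apply_le`). Covering by windows shows that such θ form an m_{A*y}-null set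
(`measure_eq_zero_of_quadratic_bound`). The vectors whose spectral measure vanishes there form a
closed subspace that reduces U and contains R(A*), so cyclicity extends the conclusion to every x.

What remains of J lies in N, M and the countable set of eigenvalue angles. All three are
Lebesgue-null, which gives (a). A countable set carries no singular continuous mass, which gives
(b). -/

noncomputable section

namespace Floquet

/-! ### Factored perturbations, the Fredholm alternative, weak cluster points -/

section Operators

variable {H K : Type*}
  [NormedAddCommGroup H] [InnerProductSpace ℂ H] [CompleteSpace H]
  [NormedAddCommGroup K] [InnerProductSpace ℂ K] [CompleteSpace K]

/-- The exponential of an operator that factors through `K` is `1` plus such an operator. -/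
theorem exists_exp_eq_one_add (A : H →L[ℂ] K) (D : K →L[ℂ] H) (W : K →L[ℂ] K) :
    ∃ Z : K →L[ℂ] K, NormedSpace.exp (D ∘L W ∘L A) = 1 + D ∘L Z ∘L A := by
  set T : K →L[ℂ] K := W ∘L A ∘L D with hT
  set X : H →L[ℂ] H := D ∘L W ∘L A with hX
  have hpow : ∀ n : ℕ, X ^ (n + 1) = D ∘L (T ^ n * W) ∘L A := by
    intro n
    induction n with
    | zero => simp [hX]
    | succ n ih =>
      rw [pow_succ' X, ih, pow_succ' T]
      ext x
      simp [hX, hT]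
  -- Dominated by the exponential series of T, since 1/(n+1)! ≤ 1/n!.
  have hsum : Summable fun n : ℕ => (((n + 1).factorial : ℂ)⁻¹) • (T ^ n * W) := by
    refine Summable.of_norm_bounded
      ((NormedSpace.norm_expSeries_summable' (𝕂 := ℂ) T).mul_right ‖W‖) fun n => ?_
    rw [norm_smul, norm_smul, mul_assoc]
    refine mul_le_mul ?_ (norm_mul_le _ _) (norm_nonneg _) (norm_nonneg _)
    rw [norm_inv, norm_inv, Complex.norm_natCast, Complex.norm_natCast]
    gcongr
    omega
  let Φ : (K →L[ℂ] K) →L[ℂ] (H →L[ℂ] H) :=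
    (ContinuousLinearMap.compL ℂ H K H D) ∘L (ContinuousLinearMap.compL ℂ H K K).flip A
  have h1 := hsum.hasSum.mapL Φ
  have h2 : HasSum (fun n : ℕ => ((n.factorial : ℂ)⁻¹) • X ^ n) (NormedSpace.exp X) :=
    NormedSpace.exp_series_hasSum_exp' X
  have h3 := (hasSum_nat_add_iff' 1).2 h2
  refine ⟨∑' n : ℕ, (((n + 1).factorial : ℂ)⁻¹) • (T ^ n * W), ?_⟩
  rw [← sub_eq_iff_eq_add']
  have h4 : HasSum (fun n : ℕ => (((n + 1).factorial : ℂ)⁻¹) • X ^ (n + 1))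
      (NormedSpace.exp X - 1) := by simpa using h3
  refine h4.unique ?_
  convert h1 using 2 with n
  · rw [hpow, map_smul]
    rfl
  · rfl

/-- Interchange of factors: `1 + LR` is invertible when `1 + RL` is. -/
theorem isUnit_one_add_comp {E F : Type*} [NormedAddCommGroup E] [NormedSpace ℂ E]
    [NormedAddCommGroup F] [NormedSpace ℂ F] (L : E →L[ℂ] F) (R : F →L[ℂ] E)
    (h : IsUnit (1 + R ∘L L)) : IsUnit (1 + L ∘L R) := by
  obtain ⟨u, hu⟩ := h
  have h1 : ∀ x, (u⁻¹ : (E →L[ℂ] E)ˣ).1 x + (u⁻¹ : (E →L[ℂ] E)ˣ).1 (R (L x)) = x := fun x => by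
    simpa [hu] using congrArg (fun T : E →L[ℂ] E => T x) u.inv_mul
  have h2 : ∀ x, (u⁻¹ : (E →L[ℂ] E)ˣ).1 x + R (L ((u⁻¹ : (E →L[ℂ] E)ˣ).1 x)) = x := fun x => by
    simpa [hu] using congrArg (fun T : E →L[ℂ] E => T x) u.mul_inv
  -- The inverse is 1 - L(1 + RL)⁻¹R.
  refine ⟨⟨1 + L ∘L R, 1 - L ∘L u⁻¹.1 ∘L R, ?_, ?_⟩, rfl⟩
  · ext x
    have h3 := congrArg L (h2 (R x))
    simp only [map_add] at h3
    simp only [mul_apply_eq_comp, ContinuousLinearMap.comp_apply, add_apply, sub_apply,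
      one_apply_eq_self, map_sub]
    rw [← h3]
    abel
  · ext x
    have h3 := congrArg L (h1 (R x))
    simp only [map_add] at h3
    simp only [mul_apply_eq_comp, ContinuousLinearMap.comp_apply, add_apply, sub_apply,
      one_apply_eq_self, map_add]
    rw [sub_add_sub_comm, h3, add_sub_cancel_right]

/-- The Fredholm alternative for a compact perturbation of an invertible operator. -/
theorem isUnit_sub_of_injective {E : Type*} [NormedAddCommGroup E] [NormedSpace ℂ E]
    [CompleteSpace E] {B T : E →L[ℂ] E} (hB : IsUnit B) (hT : IsCompactOperator T)
    (hinj : ∀ x, B x = T x → x = 0) : IsUnit (B - T) := by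
  obtain ⟨u, rfl⟩ := hB
  -- B - T = B(1 - B⁻¹T), and injectivity excludes the eigenvalue 1 of the compact B⁻¹T.
  have hcomp : IsCompactOperator (u⁻¹.1 * T : E →L[ℂ] E) := hT.clm_comp u⁻¹.1
  rcases hcomp.hasEigenvalue_or_mem_resolventSet one_ne_zero with h | h
  · obtain ⟨v, hv⟩ := h.exists_hasEigenvector
    refine absurd (hinj v ?_) hv.2
    have h1 : u⁻¹.1 (T v) = v := by simpa using hv.apply_eq_smul
    calc u.1 v = u.1 (u⁻¹.1 (T v)) := by rw [h1]
      _ = T v := congrArg (fun S : E →L[ℂ] E => S (T v)) u.mul_inv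
  · rw [spectrum.mem_resolventSet_iff, map_one] at h
    have h2 := u.isUnit.mul h
    rwa [mul_sub, mul_one, ← mul_assoc, u.mul_inv, one_mul] at h2

/-- A bounded sequence in a Hilbert space has a weak cluster point. -/
theorem exists_weak_cluster_point {f : ℕ → H} {C : ℝ} (hf : ∀ n, ‖f n‖ ≤ C) :
    ∃ g : H, ∀ (h : H) (c : ℂ), Tendsto (fun n => inner ℂ (f n) h) atTop (𝓝 c) →
      inner ℂ g h = c := by
  -- A limit along one free ultrafilter serves all test vectors h at once, without extracting a
  -- subsequence.
  let F : Ultrafilter ℕ := hyperfilter ℕ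
  have hF : (F : Filter ℕ) ≤ atTop := Nat.hyperfilter_le_atTop
  let d : ℕ → WeakDual ℂ H := fun n => StrongDual.toWeakDual (InnerProductSpace.toDual ℂ H (f n))
  obtain ⟨ℓ, -, hℓ⟩ := (WeakDual.isCompact_closedBall (0 : StrongDual ℂ H) C).ultrafilter_le_nhds
    (F.map d) (by
      rw [Ultrafilter.coe_map, le_principal_iff, mem_map]
      refine Eventually.of_forall fun n => ?_
      simpa [d] using hf n)
  refine ⟨(InnerProductSpace.toDual ℂ H).symm (WeakDual.toStrongDual ℓ), fun h c hc => ?_⟩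
  rw [InnerProductSpace.toDual_symm_apply]
  exact tendsto_nhds_unique
    (((WeakDual.eval_continuous h).tendsto ℓ).comp (show Tendsto d F (𝓝 ℓ) from hℓ))
    (hc.mono_left hF)

/-- A bounded operator that converges along a sequence takes its limit at a weak cluster point. -/
theorem apply_eq_of_weak_cluster_point {f : ℕ → H} {g : H}
    (hg : ∀ (h : H) (c : ℂ), Tendsto (fun n => inner ℂ (f n) h) atTop (𝓝 c) → inner ℂ g h = c)
    (B : H →L[ℂ] K) {b : K} (hb : Tendsto (fun n => B (f n)) atTop (𝓝 b)) : B g = b := by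
  refine ext_inner_right ℂ fun h => ?_
  rw [← ContinuousLinearMap.adjoint_inner_right]
  refine hg _ _ ?_
  simp only [ContinuousLinearMap.adjoint_inner_right]
  exact hb.inner tendsto_const_nhds

end Operators

/-! ### Resolvents and spectral measures of a unitary operator -/

section Spectral

variable {H : Type*} [NormedAddCommGroup H] [InnerProductSpace ℂ H] [CompleteSpace H]

theorem inner_unitary_apply (V : unitary (H →L[ℂ] H)) (x y : H) :
    inner ℂ ((V : H →L[ℂ] H) x) ((V : H →L[ℂ] H) y) = inner ℂ x y := by
  rw [← ContinuousLinearMap.adjoint_inner_right, ← ContinuousLinearMap.star_eq_adjoint,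
    ← mul_apply_eq_comp, Unitary.coe_star_mul_self, one_apply_eq_self]

theorem norm_eq_one_of_mem_spectrum (V : unitary (H →L[ℂ] H))
    (w : spectrum ℂ (V : H →L[ℂ] H)) : ‖(w : ℂ)‖ = 1 := by
  simpa using Unitary.spectrum_subset_circle V w.2

theorem radialPoint_eq (θ ε : ℝ) :
    radialPoint θ ε = (Real.exp (-ε) : ℂ) * Complex.exp (Complex.I * θ) := by
  rw [radialPoint, Complex.ofReal_exp, ← Complex.exp_add]
  congr 1
  push_cast
  linear_combination (ε : ℂ) * Complex.I_mul_I

theorem norm_radialPoint (θ ε : ℝ) : ‖radialPoint θ ε‖ = Real.exp (-ε) := by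
  rw [radialPoint_eq, norm_mul, mul_comm Complex.I, Complex.norm_exp_ofReal_mul_I, mul_one,
    Complex.norm_real, Real.norm_of_nonneg (Real.exp_pos _).le]

theorem norm_radialPoint_ne_one (θ : ℝ) {ε : ℝ} (hε : 0 < ε) : ‖radialPoint θ ε‖ ≠ 1 := by
  rw [norm_radialPoint]
  exact (Real.exp_lt_exp.2 (by linarith : -ε < 0)).ne.trans_eq Real.exp_zero

theorem tendsto_radialPoint (θ : ℝ) :
    Tendsto (radialPoint θ) (𝓝 0) (𝓝 (Complex.exp (Complex.I * θ))) := by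
  have h : Continuous (radialPoint θ) := by
    unfold radialPoint
    fun_prop
  simpa [radialPoint] using h.tendsto 0

theorem exp_angle {w : ℂ} (hw : ‖w‖ = 1) : Complex.exp (-(Complex.I * angle w)) = w := by
  have h1 : angle w = -Complex.arg w - toIcoDiv Real.two_pi_pos 0 (-Complex.arg w) • (2 * Real.pi) :=
    (self_sub_toIcoDiv_zsmul Real.two_pi_pos 0 _).symm
  have h2 : -(Complex.I * angle w) = Complex.arg w * Complex.I +
      (toIcoDiv Real.two_pi_pos 0 (-Complex.arg w) : ℤ) * (2 * Real.pi * Complex.I) := by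
    rw [h1]
    push_cast [zsmul_eq_mul]
    ring
  rw [h2, Complex.exp_add, Complex.exp_int_mul_two_pi_mul_I, mul_one]
  simpa [hw] using Complex.norm_mul_exp_arg_mul_I w

/-- Needed because `Measure.map` returns the zero measure when the map is not a.e. measurable. -/
theorem measurable_angle : Measurable angle := by
  have h : angle = fun w => Int.fract (-Complex.arg w / (2 * Real.pi)) * (2 * Real.pi) := by
    funext w
    rw [angle, toIcoMod_eq_fract_mul]
  rw [h]
  exact (measurable_fract.comp (Complex.measurable_arg.neg.div_const _)).mul_const _

/-- The chord is at most the arc |θ - φ|, and the radial defect is 1 - e^{-ε} ≤ ε. -/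
theorem norm_one_sub_radialPoint_mul_le (θ φ : ℝ) {ε : ℝ} (hε : 0 ≤ ε) :
    ‖1 - radialPoint θ ε * Complex.exp (-(Complex.I * φ))‖ ≤ |θ - φ| + ε := by
  have h1 : radialPoint θ ε * Complex.exp (-(Complex.I * φ)) =
      (Real.exp (-ε) : ℂ) * Complex.exp (Complex.I * (θ - φ : ℝ)) := by
    rw [radialPoint_eq, mul_assoc, ← Complex.exp_add]
    congr 2
    push_cast
    ring
  have h2 : ‖Complex.exp (Complex.I * (θ - φ : ℝ))‖ = 1 := by
    rw [mul_comm, Complex.norm_exp_ofReal_mul_I]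
  have h3 : (1 : ℂ) - radialPoint θ ε * Complex.exp (-(Complex.I * φ)) =
      -(Complex.exp (Complex.I * (θ - φ : ℝ)) - 1) +
        ((1 - Real.exp (-ε) : ℝ) : ℂ) * Complex.exp (Complex.I * (θ - φ : ℝ)) := by
    rw [h1]
    push_cast
    ring
  rw [h3]
  refine (norm_add_le _ _).trans (add_le_add ?_ ?_)
  · rw [norm_neg]
    exact Real.norm_exp_I_mul_ofReal_sub_one_le
  · rw [norm_mul, h2, mul_one, Complex.norm_real, Real.norm_of_nonneg]
    · linarith [Real.add_one_le_exp (-ε)]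
    · linarith [Real.exp_le_one_iff.2 (show -ε ≤ 0 by linarith)]

theorem one_sub_mul_ne_zero {z w : ℂ} (hz : ‖z‖ ≠ 1) (hw : ‖w‖ = 1) : 1 - z * w ≠ 0 := by
  intro h
  apply hz
  have h1 : ‖z * w‖ = 1 := by rw [← sub_eq_zero.1 h, norm_one]
  simpa [hw] using h1

/-- The function `w ↦ (1 - z w)⁻¹` on the spectrum of `V`. -/
def resolventFun (V : unitary (H →L[ℂ] H)) {z : ℂ} (hz : ‖z‖ ≠ 1) :
    C(spectrum ℂ (V : H →L[ℂ] H), ℂ) where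
  toFun w := (1 - z * w)⁻¹
  continuous_toFun := (continuous_const.sub (continuous_const.mul continuous_subtype_val)).inv₀
    fun w => one_sub_mul_ne_zero hz (norm_eq_one_of_mem_spectrum V w)

theorem funcCalc_mul (V : unitary (H →L[ℂ] H)) (f g : C(spectrum ℂ (V : H →L[ℂ] H), ℂ)) :
    funcCalc V (f * g) = funcCalc V f * funcCalc V g :=
  map_mul (cfcHom (R := ℂ) (isStarNormal_of_unitary V)) f g

theorem funcCalc_one (V : unitary (H →L[ℂ] H)) : funcCalc V 1 = 1 :=
  map_one (cfcHom (R := ℂ) (isStarNormal_of_unitary V))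

theorem funcCalc_star (V : unitary (H →L[ℂ] H)) (f : C(spectrum ℂ (V : H →L[ℂ] H), ℂ)) :
    funcCalc V (star f) = star (funcCalc V f) :=
  map_star (cfcHom (R := ℂ) (isStarNormal_of_unitary V)) f

theorem funcCalc_id (V : unitary (H →L[ℂ] H)) :
    funcCalc V ((ContinuousMap.id ℂ).restrict (spectrum ℂ (V : H →L[ℂ] H))) = V :=
  cfcHom_id (R := ℂ) (isStarNormal_of_unitary V)

theorem funcCalc_one_sub_smul_id (V : unitary (H →L[ℂ] H)) (z : ℂ) :
    funcCalc V (1 - z • (ContinuousMap.id ℂ).restrict (spectrum ℂ (V : H →L[ℂ] H))) =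
      1 - z • (V : H →L[ℂ] H) := by
  rw [← funcCalc_one V]
  refine Eq.trans ?_ (congrArg (fun T => funcCalc V 1 - z • T) (funcCalc_id V))
  simp only [funcCalc, map_sub, map_smul]

/-- The inverse of `1 - zV` for `|z| ≠ 1`. -/
def resolventUnit (V : unitary (H →L[ℂ] H)) {z : ℂ} (hz : ‖z‖ ≠ 1) : (H →L[ℂ] H)ˣ where
  val := 1 - z • (V : H →L[ℂ] H)
  inv := funcCalc V (resolventFun V hz)
  val_inv := by
    rw [← funcCalc_one_sub_smul_id, ← funcCalc_mul, ← funcCalc_one]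
    congr 1
    ext w
    exact mul_inv_cancel₀ (one_sub_mul_ne_zero hz (norm_eq_one_of_mem_spectrum V w))
  inv_val := by
    rw [← funcCalc_one_sub_smul_id, ← funcCalc_mul, ← funcCalc_one]
    congr 1
    ext w
    exact inv_mul_cancel₀ (one_sub_mul_ne_zero hz (norm_eq_one_of_mem_spectrum V w))

/-- `Ring.inverse` is zero on non-units, so the formula rests on the explicit unit. -/
theorem resolventAt_eq_inv (V : unitary (H →L[ℂ] H)) {z : ℂ} (hz : ‖z‖ ≠ 1) :
    resolventAt V z = (resolventUnit V hz)⁻¹.1 :=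
  Ring.inverse_unit (resolventUnit V hz)

theorem resolventAt_eq_funcCalc (V : unitary (H →L[ℂ] H)) {z : ℂ} (hz : ‖z‖ ≠ 1) :
    resolventAt V z = funcCalc V (resolventFun V hz) :=
  resolventAt_eq_inv V hz

theorem one_sub_smul_mul_resolventAt (V : unitary (H →L[ℂ] H)) {z : ℂ} (hz : ‖z‖ ≠ 1) :
    (1 - z • (V : H →L[ℂ] H)) * resolventAt V z = 1 := by
  rw [resolventAt_eq_inv V hz]
  exact (resolventUnit V hz).mul_inv

theorem resolventAt_mul_one_sub_smul (V : unitary (H →L[ℂ] H)) {z : ℂ} (hz : ‖z‖ ≠ 1) :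
    resolventAt V z * (1 - z • (V : H →L[ℂ] H)) = 1 := by
  rw [resolventAt_eq_inv V hz]
  exact (resolventUnit V hz).inv_mul

/-- The spectral measure before passing to the coordinate `θ`. -/
def circleMeasure (V : unitary (H →L[ℂ] H)) (x : H) : Measure (spectrum ℂ (V : H →L[ℂ] H)) :=
  RealRMK.rieszMeasure (spectralFunctional V x)

instance (V : unitary (H →L[ℂ] H)) (x : H) : IsFiniteMeasure (circleMeasure V x) :=
  inferInstanceAs (IsFiniteMeasure (RealRMK.rieszMeasure _))

/-- A real continuous function as a complex-valued one. -/
def toComplexFun {X : Type*} [TopologicalSpace X] (f : C(X, ℝ)) : C(X, ℂ) :=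
  ⟨fun w => ((f w : ℝ) : ℂ), Complex.continuous_ofReal.comp f.continuous⟩

theorem integral_circleMeasure (V : unitary (H →L[ℂ] H)) (x : H)
    (f : C(spectrum ℂ (V : H →L[ℂ] H), ℝ)) :
    ∫ w, f w ∂(circleMeasure V x) = (inner ℂ x (funcCalc V (toComplexFun f) x)).re :=
  RealRMK.integral_rieszMeasure (spectralFunctional V x)
    ⟨f, HasCompactSupport.of_compactSpace f⟩

/-- Chebyshev's inequality for ‖R_V(z)x‖² = ∫ |1 - zw|⁻² dm_x: on the window |1 - zw| ≤ 2ε, so the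
integrand is at least 1/(4ε²). -/
theorem spectralMeasure_apply_le (V : unitary (H →L[ℂ] H)) (x : H) (θ : ℝ) {ε : ℝ} (hε : 0 < ε) :
    spectralMeasure V x (Set.Icc (θ - ε) (θ + ε)) ≤
      ENNReal.ofReal (4 * ε ^ 2 * ‖resolventAt V (radialPoint θ ε) x‖ ^ 2) := by
  have hz := norm_radialPoint_ne_one θ hε
  have hmeas : Measurable fun w : spectrum ℂ (V : H →L[ℂ] H) => angle (w : ℂ) :=
    measurable_angle.comp measurable_subtype_coe
  let f : C(spectrum ℂ (V : H →L[ℂ] H), ℝ) :=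
    ⟨fun w => ‖resolventFun V hz w‖ ^ 2, by fun_prop⟩
  have hf : toComplexFun f = star (resolventFun V hz) * resolventFun V hz := by
    ext w
    exact (Complex.ofReal_pow _ _).trans (Complex.conj_mul' _).symm
  have hint : ∫ w, f w ∂(circleMeasure V x) = ‖resolventAt V (radialPoint θ ε) x‖ ^ 2 := by
    rw [integral_circleMeasure, hf, funcCalc_mul, funcCalc_star,
      ContinuousLinearMap.star_eq_adjoint, mul_apply_eq_comp,
      ContinuousLinearMap.adjoint_inner_right, resolventAt_eq_funcCalc V hz]
    exact inner_self_eq_norm_sq (𝕜 := ℂ) _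
  have hsub : (fun w : spectrum ℂ (V : H →L[ℂ] H) => angle (w : ℂ)) ⁻¹'
      Set.Icc (θ - ε) (θ + ε) ⊆ {w | (4 * ε ^ 2)⁻¹ ≤ f w} := by
    intro w hw
    have hw1 := norm_eq_one_of_mem_spectrum V w
    have h1 : ‖1 - radialPoint θ ε * w‖ ≤ 2 * ε := by
      have h2 := norm_one_sub_radialPoint_mul_le θ (angle w) hε.le
      rw [exp_angle hw1] at h2
      have h3 : |θ - angle w| ≤ ε := by
        rw [abs_le]
        constructor <;> linarith [hw.1, hw.2]
      linarith
    have h4 : 0 < ‖1 - radialPoint θ ε * w‖ := norm_pos_iff.2 (one_sub_mul_ne_zero hz hw1)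
    change (4 * ε ^ 2)⁻¹ ≤ ‖(1 - radialPoint θ ε * w)⁻¹‖ ^ 2
    rw [norm_inv, inv_pow]
    refine inv_anti₀ (by positivity) ?_
    calc _ ≤ (2 * ε) ^ 2 := by gcongr
      _ = _ := by ring
  have hcheb := mul_meas_ge_le_integral_of_nonneg (μ := circleMeasure V x) (f := f)
    (Eventually.of_forall fun w => sq_nonneg _) (f.continuous.integrable_of_hasCompactSupport
      (HasCompactSupport.of_compactSpace f)) (4 * ε ^ 2)⁻¹
  rw [hint, inv_mul_le_iff₀ (by positivity)] at hcheb
  rw [spectralMeasure, Measure.map_apply hmeas measurableSet_Icc]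
  refine (measure_mono hsub).trans ?_
  change circleMeasure V x _ ≤ _
  rw [← ENNReal.ofReal_toReal (measure_ne_top (circleMeasure V x) _)]
  exact ENNReal.ofReal_le_ofReal hcheb

theorem circleMeasure_ext {V : unitary (H →L[ℂ] H)}
    {μ ν : Measure (spectrum ℂ (V : H →L[ℂ] H))} [IsFiniteMeasure μ] [IsFiniteMeasure ν]
    (h : ∀ f : C(spectrum ℂ (V : H →L[ℂ] H), ℝ), ∫ w, f w ∂μ = ∫ w, f w ∂ν) : μ = ν :=
  ext_of_forall_integral_eq_of_IsFiniteMeasure fun f => h f.toContinuousMap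

theorem integrable_circle {V : unitary (H →L[ℂ] H)}
    {μ : Measure (spectrum ℂ (V : H →L[ℂ] H))} [IsFiniteMeasure μ]
    (f : C(spectrum ℂ (V : H →L[ℂ] H), ℝ)) : Integrable f μ :=
  f.continuous.integrable_of_hasCompactSupport (HasCompactSupport.of_compactSpace f)

/-- The parallelogram law for the quadratic form x ↦ ⟨f(V)x, x⟩. Dropping the term of x - y bounds
the measure of a sum, which replaces any use of the projections E. -/
theorem circleMeasure_add_add_circleMeasure_sub (V : unitary (H →L[ℂ] H)) (x y : H) :
    circleMeasure V (x + y) + circleMeasure V (x - y) =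
      (circleMeasure V x + circleMeasure V x) + (circleMeasure V y + circleMeasure V y) := by
  refine circleMeasure_ext fun f => ?_
  simp only [integral_add_measure, integrable_circle, integral_circleMeasure, ← Complex.add_re]
  congr 1
  simp only [map_add, map_sub, inner_add_left, inner_sub_left, inner_add_right, inner_sub_right]
  ring

theorem circleMeasure_smul (V : unitary (H →L[ℂ] H)) (c : ℂ) (x : H) :
    circleMeasure V (c • x) = (‖c‖₊ ^ 2) • circleMeasure V x := by
  refine circleMeasure_ext fun f => ?_
  rw [integral_smul_nnreal_measure, integral_circleMeasure, integral_circleMeasure, map_smul,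
    inner_smul_left, inner_smul_right, ← mul_assoc, Complex.conj_mul', NNReal.smul_def,
    ← Complex.ofReal_pow, Complex.re_ofReal_mul]
  simp

theorem circleMeasure_map_eq (V : unitary (H →L[ℂ] H)) {T : H →L[ℂ] H}
    (hT : ∀ x y, inner ℂ (T x) (T y) = inner ℂ x y)
    (hcomm : ∀ f, funcCalc V f * T = T * funcCalc V f) (x : H) :
    circleMeasure V (T x) = circleMeasure V x := by
  refine circleMeasure_ext fun f => ?_
  rw [integral_circleMeasure, integral_circleMeasure, ← hT x, ← mul_apply_eq_comp,
    hcomm, mul_apply_eq_comp]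

theorem circleMeasure_univ (V : unitary (H →L[ℂ] H)) (x : H) :
    circleMeasure V x Set.univ = ENNReal.ofReal (‖x‖ ^ 2) := by
  have h := integral_circleMeasure V x 1
  have h1 : toComplexFun (1 : C(spectrum ℂ (V : H →L[ℂ] H), ℝ)) = 1 := by
    ext w
    simp [toComplexFun]
  rw [h1, funcCalc_one, one_apply_eq_self] at h
  have h2 : (circleMeasure V x).real Set.univ = ‖x‖ ^ 2 := by
    refine Eq.trans ?_ (h.trans (inner_self_eq_norm_sq (𝕜 := ℂ) x))
    simp
  rw [← h2, ofReal_measureReal]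

theorem spectralMeasure_smul (V : unitary (H →L[ℂ] H)) (c : ℂ) (x : H) :
    spectralMeasure V (c • x) = (‖c‖₊ ^ 2) • spectralMeasure V x :=
  (congrArg (Measure.map _) (circleMeasure_smul V c x)).trans (Measure.map_smul _ _ _)

theorem spectralMeasure_add_le (V : unitary (H →L[ℂ] H)) (x y : H) :
    spectralMeasure V (x + y) ≤
      (spectralMeasure V x + spectralMeasure V x) +
        (spectralMeasure V y + spectralMeasure V y) := by
  have hmeas : Measurable fun w : spectrum ℂ (V : H →L[ℂ] H) => angle (w : ℂ) :=
    measurable_angle.comp measurable_subtype_coe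
  have h : circleMeasure V (x + y) ≤ (circleMeasure V x + circleMeasure V x) +
      (circleMeasure V y + circleMeasure V y) := by
    rw [← circleMeasure_add_add_circleMeasure_sub]
    exact Measure.le_add_right le_rfl
  have h1 := Measure.map_mono h hmeas
  rwa [Measure.map_add _ _ hmeas, Measure.map_add _ _ hmeas, Measure.map_add _ _ hmeas] at h1

theorem spectralMeasure_le_norm_sq (V : unitary (H →L[ℂ] H)) (x : H) (T : Set ℝ) :
    spectralMeasure V x T ≤ ENNReal.ofReal (‖x‖ ^ 2) := by
  have hmeas : Measurable fun w : spectrum ℂ (V : H →L[ℂ] H) => angle (w : ℂ) :=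
    measurable_angle.comp measurable_subtype_coe
  refine (measure_mono T.subset_univ).trans ?_
  rw [spectralMeasure, Measure.map_apply hmeas MeasurableSet.univ, Set.preimage_univ]
  exact (circleMeasure_univ V x).le

theorem funcCalc_mul_comm (V : unitary (H →L[ℂ] H)) (f g : C(spectrum ℂ (V : H →L[ℂ] H), ℂ)) :
    funcCalc V f * funcCalc V g = funcCalc V g * funcCalc V f := by
  rw [← funcCalc_mul, mul_comm, funcCalc_mul]

theorem spectralMeasure_apply_unitary (V : unitary (H →L[ℂ] H)) (x : H) :
    spectralMeasure V ((V : H →L[ℂ] H) x) = spectralMeasure V x := by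
  refine congrArg (Measure.map _) (circleMeasure_map_eq V (inner_unitary_apply V)
    (fun f => ?_) x)
  refine (congrArg (fun T => funcCalc V f * T) (funcCalc_id V)).symm.trans ?_
  rw [funcCalc_mul_comm, funcCalc_id]

/-- The vectors whose spectral measure does not charge `T`. -/
def nullSubspace (V : unitary (H →L[ℂ] H)) (T : Set ℝ) : Submodule ℂ H where
  carrier := {x | spectralMeasure V x T = 0}
  zero_mem' := le_antisymm ((spectralMeasure_le_norm_sq V 0 T).trans (by simp)) zero_le
  add_mem' {x y} hx hy := by
    have h := spectralMeasure_add_le V x y T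
    simpa [show spectralMeasure V x T = 0 from hx, show spectralMeasure V y T = 0 from hy] using h
  smul_mem' c x hx := by
    change spectralMeasure V (c • x) T = 0
    rw [spectralMeasure_smul, Measure.smul_apply, show spectralMeasure V x T = 0 from hx, smul_zero]

/-- If y charges T with mass 0, then m_x(T) ≤ 2 m_{x-y}(T) ≤ 2‖x - y‖². -/
theorem isClosed_nullSubspace (V : unitary (H →L[ℂ] H)) (T : Set ℝ) :
    IsClosed (nullSubspace V T : Set H) := by
  refine isClosed_of_closure_subset fun x hx => ?_
  obtain ⟨y, hy, hyx⟩ := mem_closure_iff_seq_limit.1 hx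
  have hbound : ∀ n, spectralMeasure V x T ≤
      ENNReal.ofReal (‖x - y n‖ ^ 2) + ENNReal.ofReal (‖x - y n‖ ^ 2) := fun n => by
    have h := spectralMeasure_add_le V (x - y n) (y n) T
    rw [sub_add_cancel] at h
    simp only [Measure.add_apply, show spectralMeasure V (y n) T = 0 from hy n, add_zero] at h
    exact h.trans (add_le_add (spectralMeasure_le_norm_sq _ _ _)
      (spectralMeasure_le_norm_sq _ _ _))
  have hlim : Tendsto (fun n => ENNReal.ofReal (‖x - y n‖ ^ 2)) atTop (𝓝 0) := by
    have h : Tendsto (fun n => ‖x - y n‖ ^ 2) atTop (𝓝 (‖x - x‖ ^ 2)) :=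
      ((tendsto_const_nhds.sub hyx).norm).pow 2
    simpa using ENNReal.tendsto_ofReal h
  have h0 := ge_of_tendsto' (hlim.add hlim) hbound
  exact le_antisymm (h0.trans (by simp)) zero_le

/-- The equivalence gives invariance under both V and V⁻¹, as reduction requires. -/
theorem apply_mem_nullSubspace_iff (V : unitary (H →L[ℂ] H)) (T : Set ℝ) (x : H) :
    (V : H →L[ℂ] H) x ∈ nullSubspace V T ↔ x ∈ nullSubspace V T := by
  change spectralMeasure V _ T = 0 ↔ spectralMeasure V x T = 0
  rw [spectralMeasure_apply_unitary]

end Spectral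

/-! ### Null sets from quadratic decay of window masses -/

section Covering

/-- A set is null when the measure of small intervals around each of its points is quadratically
small. -/
theorem measure_eq_zero_of_quadratic_bound (μ : Measure ℝ) {T : Set ℝ} {L : ℕ}
    (hT : T ⊆ Set.Ico 0 (L : ℝ))
    (h : ∀ θ ∈ T, ∃ C : ℝ, ∀ᶠ n : ℕ in atTop,
      μ (Set.Icc (θ - 1 / ((n : ℝ) + 1)) (θ + 1 / ((n : ℝ) + 1))) ≤
        ENNReal.ofReal (C * (1 / ((n : ℝ) + 1)) ^ 2)) : μ T = 0 := by
  -- The index k serves both as the constant and as the threshold from which the bound holds, so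
  -- countably many sets exhaust T.
  let S : ℕ → Set ℝ := fun k => {θ ∈ T | ∀ n ≥ k,
    μ (Set.Icc (θ - 1 / ((n : ℝ) + 1)) (θ + 1 / ((n : ℝ) + 1))) ≤
      ENNReal.ofReal (k * (1 / ((n : ℝ) + 1)) ^ 2)}
  have hTS : T ⊆ ⋃ k, S k := by
    intro θ hθ
    obtain ⟨C, hC⟩ := h θ hθ
    obtain ⟨N, hN⟩ := eventually_atTop.1 hC
    obtain ⟨M, hM⟩ := exists_nat_ge C
    refine Set.mem_iUnion.2 ⟨max N M, hθ, fun n hn => ?_⟩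
    refine (hN n (le_trans (le_max_left _ _) hn)).trans (ENNReal.ofReal_le_ofReal ?_)
    gcongr
    exact hM.trans (by exact_mod_cast le_max_right N M)
  refine measure_mono_null hTS (measure_iUnion_null fun k => ?_)
  have hbound : ∀ n ≥ k, μ (S k) ≤ ENNReal.ofReal (L * k * (1 / ((n : ℝ) + 1))) := by
    intro n hn
    have hpos : (0 : ℝ) < (n : ℝ) + 1 := by positivity
    -- [0, L) is covered by L(n+1) intervals of length 1/(n+1). One that meets S k lies in the
    -- window about a meeting point, so the total mass is at most L(n+1)·k/(n+1)² = Lk/(n+1).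
    have hcov : S k ⊆ ⋃ j ∈ Finset.range (L * (n + 1)),
        S k ∩ Set.Icc ((j : ℝ) / (n + 1)) (((j : ℝ) + 1) / (n + 1)) := by
      intro θ hθ
      have h0 := hT hθ.1
      have h1 : 0 ≤ θ * ((n : ℝ) + 1) := mul_nonneg h0.1 hpos.le
      refine Set.mem_biUnion (x := ⌊θ * ((n : ℝ) + 1)⌋₊) ?_ ⟨hθ, ?_, ?_⟩
      · refine Finset.mem_coe.2 (Finset.mem_range.2 ((Nat.floor_lt h1).2 ?_))
        push_cast
        exact mul_lt_mul_of_pos_right h0.2 hpos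
      · exact (div_le_iff₀ hpos).2 (Nat.floor_le h1)
      · exact (le_div_iff₀ hpos).2 (Nat.lt_floor_add_one _).le
    have hpiece : ∀ j : ℕ, μ (S k ∩ Set.Icc ((j : ℝ) / (n + 1)) (((j : ℝ) + 1) / (n + 1))) ≤
        ENNReal.ofReal (k * (1 / ((n : ℝ) + 1)) ^ 2) := by
      intro j
      rcases Set.eq_empty_or_nonempty
        (S k ∩ Set.Icc ((j : ℝ) / (n + 1)) (((j : ℝ) + 1) / (n + 1))) with he | ⟨θ, hθ, hθj⟩
      · simp [he]
      · refine (measure_mono ?_).trans (hθ.2 n hn)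
        rintro φ ⟨-, hφ⟩
        rw [add_div] at hφ hθj
        exact ⟨by linarith [hφ.1, hθj.2], by linarith [hφ.2, hθj.1]⟩
    calc μ (S k) ≤ ∑ j ∈ Finset.range (L * (n + 1)),
          μ (S k ∩ Set.Icc ((j : ℝ) / (n + 1)) (((j : ℝ) + 1) / (n + 1))) :=
          (measure_mono hcov).trans (measure_biUnion_finset_le _ _)
      _ ≤ ∑ _j ∈ Finset.range (L * (n + 1)), ENNReal.ofReal (k * (1 / ((n : ℝ) + 1)) ^ 2) :=
          Finset.sum_le_sum fun j _ => hpiece j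
      _ = ENNReal.ofReal (L * k * (1 / ((n : ℝ) + 1))) := by
          rw [Finset.sum_const, Finset.card_range, nsmul_eq_mul, ← ENNReal.ofReal_natCast,
            ← ENNReal.ofReal_mul (by positivity)]
          congr 1
          push_cast
          field_simp
  have hlim : Tendsto (fun n : ℕ => ENNReal.ofReal (L * k * (1 / ((n : ℝ) + 1)))) atTop (𝓝 0) := by
    simpa using ENNReal.tendsto_ofReal
      ((tendsto_one_div_add_atTop_nhds_zero_nat (𝕜 := ℝ)).const_mul ((L : ℝ) * k))
  exact le_antisymm (ge_of_tendsto hlim (eventually_atTop.2 ⟨k, hbound⟩)) zero_le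

end Covering

/-! ### Countability of the eigenvalues -/

section Eigenvalues

variable {H : Type*} [NormedAddCommGroup H] [InnerProductSpace ℂ H] [CompleteSpace H]

/-- The angles `θ ∈ [0, 2π)` for which `e^{-iθ}` is an eigenvalue of `V`. -/
def eigenAngles (V : unitary (H →L[ℂ] H)) : Set ℝ :=
  {θ ∈ Set.Ico 0 (2 * Real.pi) |
    ∃ g : H, g ≠ 0 ∧ Complex.exp (Complex.I * θ) • (V : H →L[ℂ] H) g = g}

theorem exp_I_mul_injOn :
    Set.InjOn (fun θ : ℝ => Complex.exp (Complex.I * θ)) (Set.Ico 0 (2 * Real.pi)) := by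
  intro a ha b hb hab
  obtain ⟨n, hn⟩ := Complex.exp_eq_exp_iff_exists_int.1 hab
  have h1 : Complex.I * ((a : ℂ) - (b + n * (2 * Real.pi))) = 0 := by linear_combination hn
  have h2 : a - (b + n * (2 * Real.pi)) = 0 := by
    exact_mod_cast (mul_eq_zero.1 h1).resolve_left Complex.I_ne_zero
  have hpi := Real.two_pi_pos
  have h3 : (n : ℝ) < 1 := by
    by_contra! h
    nlinarith [ha.2, hb.1]
  have h4 : (-1 : ℝ) < n := by
    by_contra! h
    nlinarith [ha.1, hb.2]
  have h5 : n = 0 := by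
    have : n < 1 := by exact_mod_cast h3
    have : -1 < n := by exact_mod_cast h4
    omega
  rw [h5] at h2
  simp only [Int.cast_zero, zero_mul, add_zero] at h2
  linarith

theorem inner_eq_zero_of_eigenAngles {V : unitary (H →L[ℂ] H)} {a b : ℝ} {g h : H}
    (hg : Complex.exp (Complex.I * a) • (V : H →L[ℂ] H) g = g)
    (hh : Complex.exp (Complex.I * b) • (V : H →L[ℂ] H) h = h)
    (hab : Complex.exp (Complex.I * a) ≠ Complex.exp (Complex.I * b)) : inner ℂ g h = 0 := by
  have h1 : inner ℂ g h =
      (starRingEnd ℂ) (Complex.exp (Complex.I * a)) * Complex.exp (Complex.I * b) *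
        inner ℂ g h := by
    conv_lhs => rw [← hg, ← hh, inner_smul_left, inner_smul_right, inner_unitary_apply]
    ring
  have h2 : (starRingEnd ℂ) (Complex.exp (Complex.I * a)) * Complex.exp (Complex.I * a) = 1 := by
    rw [Complex.conj_mul', mul_comm Complex.I, Complex.norm_exp_ofReal_mul_I]
    simp
  by_contra hne
  have h3 := mul_right_cancel₀ hne ((one_mul _).trans h1)
  rw [← h2] at h3
  exact hab (mul_left_cancel₀ (left_ne_zero_of_mul_eq_one h2) h3)

/-- Unit eigenvectors for distinct eigenvalues are orthogonal, hence √2 apart. The balls of radius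
1/2 about them are disjoint, and a separable space holds only countably many. -/
theorem countable_eigenAngles [TopologicalSpace.SeparableSpace H] (V : unitary (H →L[ℂ] H)) :
    (eigenAngles V).Countable := by
  have hex : ∀ θ ∈ eigenAngles V, ∃ g : H, ‖g‖ = 1 ∧
      Complex.exp (Complex.I * θ) • (V : H →L[ℂ] H) g = g := by
    rintro θ ⟨-, g, hg0, hg⟩
    refine ⟨((‖g‖⁻¹ : ℝ) : ℂ) • g, ?_, ?_⟩
    · rw [norm_smul, Complex.norm_real, norm_inv, norm_norm, inv_mul_cancel₀ (norm_ne_zero_iff.2 hg0)]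
    · rw [map_smul, smul_comm, hg]
  choose! g hg1 hg using hex
  refine Set.PairwiseDisjoint.countable_of_isOpen (s := fun θ => Metric.ball (g θ) (1 / 2)) ?_
    (fun θ _ => Metric.isOpen_ball) fun θ _ => Metric.nonempty_ball.2 (by norm_num)
  intro a ha b hb hab
  refine Metric.ball_disjoint_ball ?_
  have h0 : inner ℂ (g a) (g b) = 0 := inner_eq_zero_of_eigenAngles (hg a ha) (hg b hb)
    (exp_I_mul_injOn.ne ha.1 hb.1 hab)
  have h1 : ‖g a - g b‖ ^ 2 = 2 := by
    rw [norm_sub_sq (𝕜 := ℂ), h0, hg1 a ha, hg1 b hb]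
    norm_num
  rw [dist_eq_norm]
  nlinarith [norm_nonneg (g a - g b)]

end Eigenvalues

/-! ### Boundary behaviour of the perturbed resolvent -/

section Perturbation

variable {H K : Type*}
  [NormedAddCommGroup H] [InnerProductSpace ℂ H] [CompleteSpace H]
  [NormedAddCommGroup K] [InnerProductSpace ℂ K] [CompleteSpace K]

/-- The resolvent identity for `V = (1 + A^* Z A) U` on the range of `A^*`. -/
theorem resolventAt_comp_adjoint {U V : unitary (H →L[ℂ] H)} {A : H →L[ℂ] K} {Z : K →L[ℂ] K}
    (hV : (V : H →L[ℂ] H) = (1 + A.adjoint ∘L Z ∘L A) * U) {z : ℂ} (hz : ‖z‖ ≠ 1) (y : K) :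
    resolventAt V z (A.adjoint (((1 + (Z ∘L A) ∘L A.adjoint) - Z ∘L Q U A z) y)) =
      resolventAt U z (A.adjoint y) := by
  have h1 := congrArg (fun T : H →L[ℂ] H => T (A.adjoint y)) (one_sub_smul_mul_resolventAt U hz)
  simp only [mul_apply_eq_comp, sub_apply, smul_apply, one_apply_eq_self] at h1
  set r := resolventAt U z (A.adjoint y) with hr
  have h2 := congrArg (fun T : H →L[ℂ] H => T r) (resolventAt_mul_one_sub_smul V hz)
  simp only [mul_apply_eq_comp, sub_apply, smul_apply, one_apply_eq_self] at h2
  rw [← h2]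
  congr 1
  -- With r = R_U(z)A*y one has zVr = (1 + A*ZA)(r - A*y) and Ar = Q(z)y, so (1 - zV)r = A*(1 + ZAA*
  -- - ZQ(z))y.
  have h3 : z • (U : H →L[ℂ] H) r = r - A.adjoint y := by rw [← h1]; abel
  rw [hV, mul_apply_eq_comp, ← map_smul, h3]
  simp only [Q, add_apply, sub_apply, ContinuousLinearMap.comp_apply, one_apply_eq_self, map_add,
    map_sub, ← hr]
  abel

theorem norm_sq_resolventAt_le (U : unitary (H →L[ℂ] H)) (A : H →L[ℂ] K) (ε θ : ℝ) (y : K) :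
    ‖resolventAt U (radialPoint θ ε) (A.adjoint y)‖ ^ 2 ≤ ‖G U A ε θ‖ * ‖y‖ ^ 2 := by
  have h : inner ℂ y (G U A ε θ y) =
      ((‖resolventAt U (radialPoint θ ε) (A.adjoint y)‖ ^ 2 : ℝ) : ℂ) := by
    simp only [G, ContinuousLinearMap.comp_apply]
    rw [← ContinuousLinearMap.adjoint_inner_left, ContinuousLinearMap.adjoint_inner_right,
      inner_self_eq_norm_sq_to_K]
    simp
  have h1 : ‖resolventAt U (radialPoint θ ε) (A.adjoint y)‖ ^ 2 = ‖inner ℂ y (G U A ε θ y)‖ := by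
    rw [h, Complex.norm_real, Real.norm_of_nonneg (by positivity)]
  rw [h1]
  calc _ ≤ ‖y‖ * (‖G U A ε θ‖ * ‖y‖) :=
        (norm_inner_le_norm _ _).trans (by gcongr; exact ContinuousLinearMap.le_opNorm _ _)
    _ = _ := by ring

theorem tendsto_one_div_add_nhdsGT :
    Tendsto (fun n : ℕ => 1 / ((n : ℝ) + 1)) atTop (𝓝[>] 0) :=
  tendsto_nhdsWithin_iff.2 ⟨tendsto_one_div_add_atTop_nhds_zero_nat,
    Eventually.of_forall fun n => Set.mem_Ioi.2 (by positivity)⟩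

/-- Uniform boundedness needs a pointwise bound over the whole family. A convergent sequence
supplies it, whereas convergence as ε ↓ 0 bounds only ε below a threshold that depends on the
vector. -/
theorem GStrongLimitExists.exists_bound {U : unitary (H →L[ℂ] H)} {A : H →L[ℂ] K} {θ : ℝ}
    (h : GStrongLimitExists U A θ) : ∃ C : ℝ, ∀ n : ℕ, ‖G U A (1 / ((n : ℝ) + 1)) θ‖ ≤ C := by
  obtain ⟨G₀, hG₀⟩ := h
  refine banach_steinhaus fun x => ?_
  obtain ⟨C, hC⟩ := ((hG₀ x).comp tendsto_one_div_add_nhdsGT).norm.bddAbove_range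
  exact ⟨C, fun n => hC ⟨n, rfl⟩⟩

/-- At a point where the boundary values exist, either `V` has an eigenvalue or its resolvent
stays bounded on the range of `A^*`. -/
theorem mem_eigenAngles_or_bounded {U V : unitary (H →L[ℂ] H)} {A : H →L[ℂ] K} {Z : K →L[ℂ] K}
    (hV : (V : H →L[ℂ] H) = (1 + A.adjoint ∘L Z ∘L A) * U)
    (hB : IsUnit (1 + A.adjoint ∘L Z ∘L A))
    (hcomp : ∀ z : ℂ, ‖z‖ ≠ 1 → IsCompactOperator (Q U A z))
    {θ : ℝ} (hθ : θ ∈ Set.Ico 0 (2 * Real.pi))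
    (hG : GStrongLimitExists U A θ) (hQ : QNormLimitExists U A θ) :
    θ ∈ eigenAngles V ∨ ∀ y : K, ∃ C : ℝ, ∀ᶠ n : ℕ in atTop,
      ‖resolventAt V (radialPoint θ (1 / ((n : ℝ) + 1))) (A.adjoint y)‖ ^ 2 ≤ C := by
  obtain ⟨C, hC⟩ := hG.exists_bound
  obtain ⟨⟨Q₀, hQ₀⟩, -⟩ := hQ
  have hpos : ∀ n : ℕ, 0 < 1 / ((n : ℝ) + 1) := fun n => by positivity
  set z : ℕ → ℂ := fun n => radialPoint θ (1 / ((n : ℝ) + 1)) with hzdef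
  have hz : ∀ n, ‖z n‖ ≠ 1 := fun n => norm_radialPoint_ne_one θ (hpos n)
  have hzlim : Tendsto z atTop (𝓝 (Complex.exp (Complex.I * θ))) :=
    (tendsto_radialPoint θ).comp tendsto_one_div_add_atTop_nhds_zero_nat
  have hQlim : Tendsto (fun n => Q U A (z n)) atTop (𝓝 Q₀) := hQ₀.comp tendsto_one_div_add_nhdsGT
  have hQ₀comp : IsCompactOperator Q₀ :=
    isCompactOperator_of_tendsto hQlim (Eventually.of_forall fun n => hcomp _ (hz n))
  have hB' : IsUnit (1 + (Z ∘L A) ∘L A.adjoint) := isUnit_one_add_comp _ _ hB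
  have hresU : ∀ (y : K) (n : ℕ), ‖resolventAt U (z n) (A.adjoint y)‖ ^ 2 ≤ C * ‖y‖ ^ 2 :=
    fun y n => (norm_sq_resolventAt_le U A _ θ y).trans (by gcongr; exact hC n)
  by_cases hinj : ∀ y, (1 + (Z ∘L A) ∘L A.adjoint) y = (Z ∘L Q₀) y → y = 0
  · right
    intro y
    obtain ⟨u, hu⟩ := isUnit_sub_of_injective hB' (hQ₀comp.clm_comp Z) hinj
    have hY : Tendsto (fun n => (1 + (Z ∘L A) ∘L A.adjoint) - Z ∘L Q U A (z n)) atTop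
        (𝓝 u.1) := by
      rw [hu]
      exact tendsto_const_nhds.sub
        (((ContinuousLinearMap.compL ℂ K K K Z).continuous.tendsto Q₀).comp hQlim)
    -- Inversion is continuous at the limit u, so the inverses eventually exist with norm at most
    -- ‖u⁻¹‖ + 1.
    have hYinv := (NormedRing.inverse_continuousAt u).tendsto.comp hY
    have hunit := hY.eventually (Units.nhds u)
    have hbd := hYinv.norm.eventually (ge_mem_nhds (lt_add_one _))
    have hC0 : 0 ≤ C := (norm_nonneg _).trans (hC 0)
    refine ⟨C * ((‖Ring.inverse u.1‖ + 1) * ‖y‖) ^ 2, ?_⟩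
    filter_upwards [hunit, hbd] with n hn1 hn2
    obtain ⟨v, hv⟩ := hn1
    -- Applied to v⁻¹y, the identity reads R_V(z)A*y = R_U(z)A*v⁻¹y.
    have h1 := resolventAt_comp_adjoint hV (hz n) (v⁻¹.1 y)
    rw [← hv, ← mul_apply_eq_comp, v.mul_inv, one_apply_eq_self] at h1
    rw [h1]
    refine (hresU _ n).trans ?_
    gcongr
    refine (ContinuousLinearMap.le_opNorm _ _).trans ?_
    gcongr
    simpa [← hv] using hn2
  · left
    push Not at hinj
    obtain ⟨φ, hφ, hφ0⟩ := hinj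
    have hbdd : ∀ n, ‖resolventAt U (z n) (A.adjoint φ)‖ ≤ Real.sqrt (C * ‖φ‖ ^ 2) :=
      fun n => Real.le_sqrt_of_sq_le (hresU φ n)
    obtain ⟨g, hg⟩ := exists_weak_cluster_point hbdd
    have hAg : A g = Q₀ φ := apply_eq_of_weak_cluster_point hg A
      (((ContinuousLinearMap.apply ℂ K φ).continuous.tendsto Q₀).comp hQlim)
    -- The error made by replacing z_n with e^{iθ} is (z_n - e^{iθ})U R_U(z_n)A*φ, which tends to 0
    -- because the resolvent vectors are bounded.
    have hUg : (1 - Complex.exp (Complex.I * θ) • (U : H →L[ℂ] H)) g = A.adjoint φ := by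
      refine apply_eq_of_weak_cluster_point hg _ ?_
      have hsplit : ∀ n, (1 - Complex.exp (Complex.I * θ) • (U : H →L[ℂ] H))
          (resolventAt U (z n) (A.adjoint φ)) = A.adjoint φ +
            (z n - Complex.exp (Complex.I * θ)) •
              (U : H →L[ℂ] H) (resolventAt U (z n) (A.adjoint φ)) := by
        intro n
        have h1 := congrArg (fun T : H →L[ℂ] H => T (A.adjoint φ))
          (one_sub_smul_mul_resolventAt U (hz n))
        simp only [mul_apply_eq_comp, sub_apply, smul_apply, one_apply_eq_self] at h1 ⊢
        nth_rewrite 3 [← h1]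
        rw [sub_smul]
        abel
      simp only [hsplit]
      have hsmall : Tendsto (fun n => (z n - Complex.exp (Complex.I * θ)) •
          (U : H →L[ℂ] H) (resolventAt U (z n) (A.adjoint φ))) atTop (𝓝 0) := by
        refine squeeze_zero_norm (a := fun n => ‖z n - Complex.exp (Complex.I * θ)‖ *
          (‖(U : H →L[ℂ] H)‖ * Real.sqrt (C * ‖φ‖ ^ 2))) (fun n => ?_) ?_
        · rw [norm_smul]
          gcongr
          exact (ContinuousLinearMap.le_opNorm _ _).trans (by gcongr; exact hbdd n)
        · simpa only [sub_self, norm_zero, zero_mul] using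
            (hzlim.sub_const (Complex.exp (Complex.I * θ))).norm.mul_const
            (‖(U : H →L[ℂ] H)‖ * Real.sqrt (C * ‖φ‖ ^ 2))
      simpa using tendsto_const_nhds.add hsmall
    refine ⟨hθ, g, ?_, ?_⟩
    -- If g = 0 then Q₀φ = Ag = 0, so (1 + ZAA*)φ = 0 and φ = 0.
    · rintro rfl
      apply hφ0
      obtain ⟨v, hv⟩ := hB'
      rw [ContinuousLinearMap.comp_apply, ← hAg, map_zero, map_zero, ← hv] at hφ
      have h1 := congrArg (fun T : K →L[ℂ] K => T φ) v.inv_mul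
      simp only [mul_apply_eq_comp, one_apply_eq_self] at h1
      rw [← h1, hφ, map_zero]
    -- e^{iθ}Vg = (1 + A*ZA)(g - A*φ) = g + A*ZQ₀φ - A*(1 + ZAA*)φ = g, by the choice of φ.
    · have h1 : Complex.exp (Complex.I * θ) • (U : H →L[ℂ] H) g = g - A.adjoint φ := by
        rw [← hUg]
        simp
      have h2 := congrArg A.adjoint hφ
      simp only [add_apply, ContinuousLinearMap.comp_apply, one_apply_eq_self, map_add] at h2
      rw [hV, mul_apply_eq_comp, ← map_smul, h1]
      simp only [add_apply, ContinuousLinearMap.comp_apply, one_apply_eq_self, map_sub, hAg]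
      rw [← h2]
      abel

end Perturbation

/-! ### Cyclicity and the decomposition of the spectral measure -/

section Main

variable {H K : Type*}
  [NormedAddCommGroup H] [InnerProductSpace ℂ H] [CompleteSpace H]
  [NormedAddCommGroup K] [InnerProductSpace ℂ K] [CompleteSpace K]

theorem unitary_apply_star_apply (U : unitary (H →L[ℂ] H)) (x : H) :
    (U : H →L[ℂ] H) ((star (U : H →L[ℂ] H)) x) = x := by
  rw [← Unitary.coe_star, ← mul_apply_eq_comp, Unitary.coe_mul_star_self, one_apply_eq_self]

/-- A subspace that contains the range of `A^*` and is invariant under the perturbed operator and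
its inverse reduces the unperturbed one. -/
theorem reduces_of_perturbation {U V : unitary (H →L[ℂ] H)} {A : H →L[ℂ] K} {Z Z' : K →L[ℂ] K}
    (hV : (V : H →L[ℂ] H) = (1 + A.adjoint ∘L Z ∘L A) * U)
    (hB : (1 + A.adjoint ∘L Z' ∘L A) * (1 + A.adjoint ∘L Z ∘L A) = 1)
    {S : Submodule ℂ H} (hS : ∀ x, (V : H →L[ℂ] H) x ∈ S ↔ x ∈ S)
    (hA : Set.range A.adjoint ⊆ S) : Reduces S (U : H →L[ℂ] H) := by
  have hmem : ∀ (Z : K →L[ℂ] K) (x : H), x ∈ S → (1 + A.adjoint ∘L Z ∘L A) x ∈ S :=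
    fun Z x hx => S.add_mem hx (hA ⟨Z (A x), rfl⟩)
  have hU : ∀ x, (U : H →L[ℂ] H) x ∈ S ↔ x ∈ S := by
    intro x
    rw [← hS x, hV, mul_apply_eq_comp]
    refine ⟨hmem Z _, fun h => ?_⟩
    have h1 := hmem Z' _ h
    rwa [← mul_apply_eq_comp, hB, one_apply_eq_self] at h1
  refine ⟨fun x hx => (hU x).2 hx, fun x hx => ?_⟩
  rw [Submodule.mem_orthogonal] at hx ⊢
  intro u hu
  -- Write u = U(U*u). By the equivalence `hU`, U*u is again in S, and unitarity removes U from both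
  -- factors.
  rw [← unitary_apply_star_apply U u, inner_unitary_apply]
  exact hx _ ((hU _).1 (by rwa [unitary_apply_star_apply]))

/-- The absolutely continuous part is dominated by μ on T and by Lebesgue nullity off T. Only outer
measures enter, so T and J need not be measurable. -/
theorem acPart_eq_zero_of {μ : Measure ℝ} {T J : Set ℝ} (hT : μ T = 0) (hJ : volume (J \ T) = 0) :
    acPart μ J = 0 := by
  have h1 : acPart μ T = 0 :=
    le_antisymm ((Measure.withDensity_rnDeriv_le μ volume T).trans hT.le) zero_le
  have h2 : acPart μ (J \ T) = 0 := withDensity_absolutelyContinuous _ _ hJ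
  exact measure_mono_null (by rw [Set.union_sdiff_self]; exact Set.subset_union_right)
    (measure_union_null h1 h2)

theorem scPart_eq_zero_of {μ : Measure ℝ} {T C : Set ℝ} (hT : μ (T \ C) = 0) (hC : C.Countable) :
    scPart μ T = 0 := by
  have hle : scPart μ ≤ μ := Measure.restrict_le_self.trans (Measure.singularPart_le μ volume)
  have h1 : scPart μ (T \ C) = 0 := le_antisymm ((hle _).trans hT.le) zero_le
  have h2 : scPart μ C = 0 := by
    rw [← Set.biUnion_of_singleton C]
    -- An atom of μ is removed by the restriction in `scPart`; any other point is already μ-null.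
    refine (measure_biUnion_null_iff hC).2 fun θ _ => ?_
    rw [scPart, Measure.restrict_apply (measurableSet_singleton θ)]
    by_cases h : μ {θ} = 0
    · exact measure_mono_null Set.inter_subset_left
        (le_antisymm ((Measure.singularPart_le μ volume _).trans h.le) zero_le)
    · rw [Set.singleton_inter_eq_empty.2 (show θ ∉ {θ | μ {θ} = 0} from h), measure_empty]
  exact measure_mono_null (by rw [Set.sdiff_union_self]; exact Set.subset_union_left)
    (measure_union_null h1 h2)

/-- Away from the exceptional sets and the eigenvalues the spectral measures of the Floquet
operator vanish. -/
theorem spectralMeasure_floquetOperator_eq_zero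
    (U : unitary (H →L[ℂ] H)) (A : H →L[ℂ] K) (W : K →L[ℂ] K) (hW : IsSelfAdjoint W)
    (hbar : ℝ) {J : Set ℝ} (hJ : J ⊆ Set.Ico 0 (2 * Real.pi))
    (hcyc : IsCyclicFor (Set.range A.adjoint) (U : H →L[ℂ] H))
    (hcomp : ∀ z : ℂ, ‖z‖ ≠ 1 → IsCompactOperator (Q U A z)) (x : H) :
    spectralMeasure (floquetOperator U A W hW hbar) x
      ((J \ (setN U A J ∪ setM U A J)) \ eigenAngles (floquetOperator U A W hW hbar)) = 0 := by
  set V := floquetOperator U A W hW hbar with hVdef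
  set T := (J \ (setN U A J ∪ setM U A J)) \ eigenAngles V with hT
  obtain ⟨Z, hZ⟩ := exists_exp_eq_one_add A A.adjoint ((Complex.I / (hbar : ℂ)) • W)
  -- The opposite exponent gives the inverse of 1 + A*ZA in the same factored form, so it too
  -- preserves any subspace containing R(A*).
  obtain ⟨Z', hZ'⟩ := exists_exp_eq_one_add A A.adjoint (-((Complex.I / (hbar : ℂ)) • W))
  have hX : A.adjoint ∘L ((Complex.I / (hbar : ℂ)) • W) ∘L A =
      (Complex.I / (hbar : ℂ)) • (A.adjoint ∘L W ∘L A) := by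
    ext x
    simp
  have hX' : A.adjoint ∘L (-((Complex.I / (hbar : ℂ)) • W)) ∘L A =
      -((Complex.I / (hbar : ℂ)) • (A.adjoint ∘L W ∘L A)) := by
    ext x
    simp
  rw [hX] at hZ
  rw [hX'] at hZ'
  have hV : (V : H →L[ℂ] H) = (1 + A.adjoint ∘L Z ∘L A) * U := by
    rw [← hZ]
    rfl
  let _ : NormedAlgebra ℚ (H →L[ℂ] H) := NormedAlgebra.restrictScalars ℚ ℂ (H →L[ℂ] H)
  have hinv : (1 + A.adjoint ∘L Z' ∘L A) * (1 + A.adjoint ∘L Z ∘L A) = 1 := by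
    rw [← hZ, ← hZ', ← NormedSpace.exp_add_of_commute (Commute.refl _).neg_left,
      neg_add_cancel, NormedSpace.exp_zero]
  have hB : IsUnit (1 + A.adjoint ∘L Z ∘L A) := hZ ▸ NormedSpace.isUnit_exp _
  have hrange : Set.range A.adjoint ⊆ nullSubspace V T := by
    rintro _ ⟨y, rfl⟩
    -- 7 is an integer above 2π.
    refine measure_eq_zero_of_quadratic_bound (L := 7) _ (fun θ hθ => ?_) fun θ hθ => ?_
    · refine ⟨(hJ hθ.1.1).1, (hJ hθ.1.1).2.trans ?_⟩
      push_cast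
      linarith [Real.pi_lt_d2]
    · have hG : GStrongLimitExists U A θ := by
        by_contra h
        exact hθ.1.2 (Or.inl ⟨hθ.1.1, h⟩)
      have hQ : QNormLimitExists U A θ := by
        by_contra h
        exact hθ.1.2 (Or.inr ⟨hθ.1.1, h⟩)
      obtain ⟨C, hC⟩ := (mem_eigenAngles_or_bounded hV hB hcomp (hJ hθ.1.1) hG hQ).resolve_left
        hθ.2 y
      refine ⟨4 * C, ?_⟩
      filter_upwards [hC] with n hn
      refine (spectralMeasure_apply_le V _ θ (by positivity)).trans
        (ENNReal.ofReal_le_ofReal ?_)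
      rw [mul_right_comm]
      gcongr
  have htop := hcyc (nullSubspace V T) (isClosed_nullSubspace V T)
    (reduces_of_perturbation hV hinv (apply_mem_nullSubspace_iff V T) hrange) hrange
  have hx : x ∈ nullSubspace V T := by rw [htop]; exact Submodule.mem_top
  exact hx

end Main

end Floquet

end

theorem mainTheorem4
    {H K : Type*}
    [NormedAddCommGroup H] [InnerProductSpace ℂ H] [CompleteSpace H]
    [TopologicalSpace.SeparableSpace H]
    [NormedAddCommGroup K] [InnerProductSpace ℂ K] [CompleteSpace K]
    [TopologicalSpace.SeparableSpace K]
    (U : unitary (H →L[ℂ] H)) (A : H →L[ℂ] K) (W : K →L[ℂ] K) (hW : IsSelfAdjoint W)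
    (hbar : ℝ) (hbar_pos : 0 < hbar)
    (J : Set ℝ) (hJ : J ⊆ Set.Ico 0 (2 * Real.pi))
    (hfin : Floquet.IsUFinite U A J)
    (hcyc : Floquet.IsCyclicFor (Set.range A.adjoint) (U : H →L[ℂ] H))
    (hcomp : ∀ z : ℂ, ‖z‖ ≠ 1 → IsCompactOperator (Floquet.Q U A z))
    (hQ : ∀ᵐ θ : ℝ, θ ∈ J → Floquet.QNormLimitExists U A θ) :
    Floquet.NoACSpectrumIn (Floquet.floquetOperator U A W hW hbar) J ∧
    Floquet.SCSpectrumInSupportedBy (Floquet.floquetOperator U A W hW hbar) J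
      (Floquet.setN U A J ∪ Floquet.setM U A J) := by
  have hzero := Floquet.spectralMeasure_floquetOperator_eq_zero U A W hW hbar hJ hcyc hcomp
  have hcount := Floquet.countable_eigenAngles (Floquet.floquetOperator U A W hW hbar)
  refine ⟨fun x => Floquet.acPart_eq_zero_of (hzero x) ?_,
    fun x => Floquet.scPart_eq_zero_of (hzero x) hcount⟩
  have hN : volume (Floquet.setN U A J) = 0 := by
    refine measure_mono_null (fun θ hθ => ?_) (ae_iff.1 hfin)
    exact fun h => hθ.2 (h hθ.1)
  have hM : volume (Floquet.setM U A J) = 0 := by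
    refine measure_mono_null (fun θ hθ => ?_) (ae_iff.1 hQ)
    exact fun h => hθ.2 (h hθ.1)
  -- J without the set of `hzero` lies in N ∪ M ∪ `eigenAngles`.
  refine measure_mono_null ?_ (measure_union_null (measure_union_null hN hM)
    (hcount.measure_zero volume))
  intro θ hθ
  by_contra h
  rw [Set.mem_union, not_or] at h
  exact hθ.2 ⟨⟨hθ.1, h.1⟩, h.2⟩
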